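/- Let $K$ be a field of prime characteristic $p$ and let $R=\bigoplus_{n\ge 0}R_n$ be a standard graded $K$-algebra (that is, a commutative graded ring with $R_0=K$, $\dim_K R_1<\infty$ and $R=K[R_1]$), with irrelevant maximal ideal $\mathfrak m=\bigoplus_{n\ge 1}R_n$. Assume that $R$ is $F$-finite (a finitely generated module over itself via the Frobenius map) and $F$-pure (the Frobenius map $R\to R$ is a pure homomorphism). For $i\in\mathbb N$ let $H^i_{\mathfrak m}(R)$ be the $i$-th local cohomology module with support in $\mathfrak m$, that is, the $i$-th cohomology of the Čech complex on a finite family of homogeneous generators of $\mathfrak m$, with its natural $\mathbb Z$-grading, and let $$a_i(R)=\max\{\alpha\in\mathbb Z \mid H^i_{\mathfrak m}(R)_\alpha\neq 0\},$$ with $a_i(R)=-\infty$ if $H^i_{\mathfrak m}(R)=0$. For $e\in\mathbb N$ let $R^{1/p^e}$ be the $R$-module of $p^e$-th roots of elements of $R$, with $r\cdot s^{1/p^e}=(r^{p^e}s)^{1/p^e}$, and put $$I_e(R)=\{r\in R \mid \varphi(r^{1/p^e})\in\mathfrak m \text{ for every } \varphi\in\operatorname{Hom}_R(R^{1/p^e},R)\}.$$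 Let $\mathcal P(R)=\bigcap_{e\in\mathbb N} I_e(R)$ be the splitting prime of $R$ and $\operatorname{sdim}(R)=\dim(R/\mathcal P(R))$ its splitting dimension. If $a_i(R)=0$ for some $i\in\mathbb N$, then $\mathcal P(R)=\mathfrak m$, and hence $\operatorname{sdim}(R)=0$. -/

import Mathlib

noncomputable section

/-! ### Frobenius pushforward, `F`-finiteness, `F`-purity -/

section Frobenius

/-- The `R`-module `F^e_* R`: the additive group of `R` with the scalar action
`r • s = r ^ (p ^ e) * s`. For reduced `R` it is identified with the `R`-module `R^{1/p^e}` of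
`p^e`-th roots, the element `s` corresponding to `s^{1/p^e}`. -/
@[nolint unusedArguments]
def FrobeniusPushforward (R : Type*) (_p _e : ℕ) : Type _ := R

namespace FrobeniusPushforward

variable (R : Type*) [CommRing R] (p : ℕ)

instance (e : ℕ) : AddCommGroup (FrobeniusPushforward R p e) :=
  inferInstanceAs (AddCommGroup R)

instance [Fact p.Prime] [CharP R p] (e : ℕ) : Module R (FrobeniusPushforward R p e) :=
  Module.compHom R (iterateFrobenius R p e)

/-- The additive identification `s ↦ s^{1/p^e}` of `R` with `F^e_* R`. -/
def of (e : ℕ) : R ≃+ FrobeniusPushforward R p e := AddEquiv.refl R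

variable [Fact p.Prime] [CharP R p]

theorem smul_of (e : ℕ) (r s : R) : r • of R p e s = of R p e (r ^ p ^ e * s) := rfl

/-- Multiplication by `c^{1/p^e}` on `R^{1/p^e}`, as an `R`-linear map. -/
def mulRoot (e : ℕ) (c : R) : FrobeniusPushforward R p e →ₗ[R] FrobeniusPushforward R p e where
  toFun s := of R p e (c * (of R p e).symm s)
  map_add' x y := by simp [mul_add]
  map_smul' r x := by
    obtain ⟨s, rfl⟩ := (of R p e).surjective x
    simp only [smul_of, AddEquiv.symm_apply_apply, RingHom.id_apply]
    rw [mul_left_comm]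

/-- The Frobenius map `R → F_* R`, `r ↦ r ^ p`, as an `R`-linear map (for reduced `R`, this is
the inclusion `R ⊆ R^{1/p}`). -/
def frobeniusLinear : R →ₗ[R] FrobeniusPushforward R p 1 where
  toFun r := of R p 1 (r ^ p)
  map_add' x y := by rw [add_pow_char, map_add]
  map_smul' r x := by
    simp only [smul_of, RingHom.id_apply, smul_eq_mul, pow_one, mul_pow]

end FrobeniusPushforward

open FrobeniusPushforward TensorProduct

variable (R : Type*) [CommRing R] (p : ℕ) [Fact p.Prime] [CharP R p]

/-- `R` is `F`-finite: it is a finitely generated module over itself via Frobenius. -/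
def IsFFinite : Prop := Module.Finite R (FrobeniusPushforward R p 1)

end Frobenius

/-- `R` is `F`-pure: the Frobenius map is a pure homomorphism, i.e. `R ⊗ M → F_* R ⊗ M` is
injective for every `R`-module `M`. -/
def IsFPure.{u} (R : Type u) [CommRing R] (p : ℕ) [Fact p.Prime] [CharP R p] : Prop :=
  ∀ (M : Type u) [AddCommGroup M] [Module R M],
    Function.Injective ((FrobeniusPushforward.frobeniusLinear R p).rTensor M)

/-! ### Standard graded algebras -/

section Graded

variable {K R : Type*} [Field K] [CommRing R] [Algebra K R]

/-- `R = ⨁_{n ≥ 0} 𝒜 n` is a standard graded `K`-algebra: `𝒜 0 = K`, `𝒜 1` is finite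
dimensional, and `R` is generated by `𝒜 1` as a `K`-algebra. -/
structure IsStandardGraded (𝒜 : ℕ → Submodule K R) [GradedAlgebra 𝒜] : Prop where
  algebraMap_injective : Function.Injective (algebraMap K R)
  range_algebraMap : Set.range (algebraMap K R) = (𝒜 0 : Set R)
  adjoin_eq_top : Algebra.adjoin K (𝒜 1 : Set R) = ⊤
  finite_one : Module.Finite K (𝒜 1)

/-- The irrelevant maximal ideal `𝔪 = ⨁_{n ≥ 1} 𝒜 n`. -/
def irrelevantIdeal (𝒜 : ℕ → Submodule K R) [GradedAlgebra 𝒜] : Ideal R :=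
  (HomogeneousIdeal.irrelevant 𝒜).toIdeal

/-! ### The splitting prime -/

section SplittingPrime

variable (p : ℕ) [Fact p.Prime] [CharP R p] (𝒜 : ℕ → Submodule K R) [GradedAlgebra 𝒜]

open FrobeniusPushforward

/-- `I_e(R) = {r ∈ R | φ(r^{1/p^e}) ∈ 𝔪 for every φ ∈ Hom_R(R^{1/p^e}, R)}`. -/
def splittingIdeal (e : ℕ) : Ideal R where
  carrier := {r | ∀ φ : FrobeniusPushforward R p e →ₗ[R] R,
    φ (of R p e r) ∈ irrelevantIdeal 𝒜}
  zero_mem' φ := by simp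
  add_mem' hx hy φ := by
    rw [map_add, map_add]
    exact add_mem (hx φ) (hy φ)
  smul_mem' c _ hx φ := hx (φ.comp (mulRoot R p e c))

/-- The splitting prime `𝒫(R) = ⋂_e I_e(R)`. -/
def splittingPrime : Ideal R := ⨅ e : ℕ, splittingIdeal p 𝒜 e

/-- The splitting dimension `sdim(R) = dim(R / 𝒫(R))`. -/
def splittingDim : WithBot ℕ∞ := ringKrullDim (R ⧸ splittingPrime p 𝒜)

end SplittingPrime

end Graded

/-! ### The Čech complex and graded local cohomology -/

section Cech

variable {R : Type*} [CommRing R] {n : ℕ} (f : Fin n → R)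

/-- The localization `R_{f_{j₁} ⋯ f_{jᵢ}}`, for `s = {j₁ < ⋯ < jᵢ}`. -/
abbrev CechLocalization (s : Finset (Fin n)) : Type _ := Localization.Away (∏ j ∈ s, f j)

/-- The degree `i` term `⨁_{j₁ < ⋯ < jᵢ} R_{f_{j₁} ⋯ f_{jᵢ}}` of the Čech complex of `f`. -/
abbrev CechCochain (i : ℕ) : Type _ :=
  (s : {s : Finset (Fin n) // s.card = i}) → CechLocalization f s.1

/-- The localization map `R_{f_s} → R_{f_t}` for `s ⊆ t`. -/
def cechRestrict {s t : Finset (Fin n)} (h : s ⊆ t) :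
    CechLocalization f s →ₐ[R] CechLocalization f t :=
  IsLocalization.liftAlgHom (M := Submonoid.powers (∏ j ∈ s, f j))
    (f := Algebra.ofId R (CechLocalization f t)) (by
      rintro ⟨_, k, rfl⟩
      have hu : IsUnit (algebraMap R (CechLocalization f t) (∏ j ∈ t, f j)) :=
        IsLocalization.Away.algebraMap_isUnit _
      have hd := map_dvd (algebraMap R (CechLocalization f t))
        (Finset.prod_dvd_prod_of_subset s t f h)
      have := (isUnit_of_dvd_unit hd hu).pow k
      simpa [Algebra.ofId_apply] using this)

/-- The Čech differential:
`(d z)_t = ∑_{j ∈ t} (-1)^{#{k ∈ t | k < j}} z_{t ∖ {j}}`. -/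
def cechDifferential (i : ℕ) : CechCochain f i →ₗ[R] CechCochain f (i + 1) :=
  LinearMap.pi fun t => ∑ j : {j // j ∈ t.1},
    ((-1 : ℤ) ^ (t.1.filter (· < j.1)).card) •
      (cechRestrict f (Finset.erase_subset j.1 t.1)).toLinearMap ∘ₗ
        LinearMap.proj (⟨t.1.erase j.1, by simp [Finset.card_erase_of_mem j.2, t.2]⟩ :
          {s : Finset (Fin n) // s.card = i})

/-- The Čech cocycles in degree `i`. -/
def cechCocycles (i : ℕ) : Submodule R (CechCochain f i) := LinearMap.ker (cechDifferential f i)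

/-- The Čech coboundaries in degree `i`. -/
def cechCoboundaries : (i : ℕ) → Submodule R (CechCochain f i)
  | 0 => ⊥
  | i + 1 => LinearMap.range (cechDifferential f i)

/-- The local cohomology module `H^i_I(R)`, `I = (f₁, …, fₙ)`: the `i`-th cohomology module of
the Čech complex of `f₁, …, fₙ`. -/
abbrev LocalCohomology (i : ℕ) : Type _ :=
  cechCocycles f i ⧸ (cechCoboundaries f i).comap (cechCocycles f i).subtype

variable {K : Type*} [Field K] [Algebra K R] (𝒜 : ℕ → Submodule K R) [GradedAlgebra 𝒜]

/-- The degree `α` part of the graded ring `R_g`, for a homogeneous element `g` of `R`: the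
fractions `a / g ^ k` with `a` homogeneous and `deg a - deg (g ^ k) = α`. -/
def awayDegree (g : R) (α : ℤ) : AddSubgroup (Localization.Away g) where
  carrier := {x | ∃ (k a b : ℕ) (r : R), r ∈ 𝒜 a ∧ g ^ k ∈ 𝒜 b ∧ (a : ℤ) - b = α ∧
      x * algebraMap R (Localization.Away g) (g ^ k) = algebraMap R (Localization.Away g) r} ∪ {0}
  zero_mem' := Or.inr rfl
  neg_mem' := by
    rintro x (⟨k, a, b, r, hr, hg, h, hx⟩ | hx)
    · exact Or.inl ⟨k, a, b, -r, neg_mem hr, hg, h, by rw [neg_mul, hx, map_neg]⟩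
    · exact Or.inr (by simp_all)
  add_mem' := by
    rintro x y (⟨k, a, b, r, hr, hg, h, hx⟩ | hx) (⟨k', a', b', r', hr', hg', h', hy⟩ | hy)
    · have e : a + b' = a' + b := by omega
      refine Or.inl ⟨k + k', a + b', b + b', r * g ^ k' + r' * g ^ k,
        add_mem (SetLike.mul_mem_graded hr hg') ?_, ?_, by push_cast; omega, ?_⟩
      · rw [e]; exact SetLike.mul_mem_graded hr' hg
      · rw [pow_add]; exact SetLike.mul_mem_graded hg hg'
      · rw [map_add, map_mul, map_mul, ← hx, ← hy, pow_add, map_mul]; ring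
    · rw [Set.mem_singleton_iff] at hy
      exact Or.inl ⟨k, a, b, r, hr, hg, h, by rw [hy, add_zero, hx]⟩
    · rw [Set.mem_singleton_iff] at hx
      exact Or.inl ⟨k', a', b', r', hr', hg', h', by rw [hx, zero_add, hy]⟩
    · rw [Set.mem_singleton_iff] at hx hy
      exact Or.inr (by rw [hx, hy, add_zero]; rfl)

/-- The degree `α` part of the graded module `⨁ R_{f_{j₁} ⋯ f_{jᵢ}}` of Čech cochains. -/
def cochainDegree (i : ℕ) (α : ℤ) : AddSubgroup (CechCochain f i) :=
  AddSubgroup.pi Set.univ fun s => awayDegree 𝒜 (∏ j ∈ s.1, f j) α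

/-- The degree `α` part `H^i_I(R)_α` of local cohomology: the classes of the cocycles that are
homogeneous of degree `α`. -/
def localCohomologyDegree (i : ℕ) (α : ℤ) : AddSubgroup (LocalCohomology f i) :=
  ((cochainDegree f 𝒜 i α).comap (cechCocycles f i).subtype.toAddMonoidHom).map
    (Submodule.mkQ _).toAddMonoidHom

open Classical in
/-- The invariant `a_i(R) = max {α | H^i_𝔪(R)_α ≠ 0}`, and `a_i(R) = -∞` (that is, `⊥`) if there
is no such maximum, computed from homogeneous generators `f` of `𝔪`. (As `H^i_𝔪(R)` is Artinian,
the maximum exists whenever `H^i_𝔪(R) ≠ 0`.) -/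
def aInvariant (i : ℕ) : WithBot ℤ :=
  if h : ∃ a : ℤ, IsGreatest {α : ℤ | localCohomologyDegree f 𝒜 i α ≠ ⊥} a then
    (h.choose : WithBot ℤ) else ⊥

end Cech

end

/-! Write q = p^e, let r ∈ 𝔪 and suppose some φ : R^{1/q} → R has u = φ(r^{1/q}) ∉ 𝔪. If z is a Čech
cocycle of degree 0, so is its Frobenius power F^e(z). As cohomology vanishes in positive degrees, 𝔪
annihilates its degree 0 part, so r · F^e(z) is a coboundary. The localizations of φ commute with
the Čech differential and carry r · F^e(z) to u · z (`smul_mem_cechCoboundaries_of_pow`), so u · z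
is a coboundary. Modulo 𝔪, u is a nonzero scalar and 𝔪 kills the class of z, so z is itself a
coboundary. This contradicts H^i_𝔪(R)_0 ≠ 0. Hence 𝔪 ⊆ I_e(R) for every e, while I_0(R) ⊆ 𝔪 is seen
from the identity map. -/

noncomputable section

/-! ### Localizing p^{-e}-linear maps -/

section LocalizedTrace

open FrobeniusPushforward

/-- The localization `S` of `R`, with `R` acting through the `e`-th iterate of Frobenius. -/
@[nolint unusedArguments]
def LocalizedPushforward (R S : Type*) (_p _e : ℕ) [CommRing R] [CommRing S] [Algebra R S] :
    Type _ := S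

variable {R : Type*} [CommRing R] (p e : ℕ)

namespace LocalizedPushforward

variable (S : Type*) [CommRing S] [Algebra R S]

instance : AddCommGroup (LocalizedPushforward R S p e) := inferInstanceAs (AddCommGroup S)

variable [Fact p.Prime] [CharP R p]

instance : Module R (LocalizedPushforward R S p e) :=
  Module.compHom S ((algebraMap R S).comp (iterateFrobenius R p e))

variable (R) in
/-- The additive identification of `S` with its Frobenius pushforward. -/
def of : S ≃+ LocalizedPushforward R S p e := AddEquiv.refl S

theorem smul_of (r : R) (s : S) :
    r • of R p e S s = of R p e S (algebraMap R S r ^ p ^ e * s) := by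
  rw [← map_pow]; rfl

/-- The localization map on Frobenius pushforwards. -/
def localizationMap : FrobeniusPushforward R p e →ₗ[R] LocalizedPushforward R S p e where
  toFun x := of R p e S (algebraMap R S ((FrobeniusPushforward.of R p e).symm x))
  map_add' x y := by simp
  map_smul' r x := by
    obtain ⟨s, rfl⟩ := (FrobeniusPushforward.of R p e).surjective x
    simp [FrobeniusPushforward.smul_of, smul_of]

variable (M : Submonoid R) [IsLocalization M S]

/-- Frobenius pushforward commutes with localization: s acts on the pushforward as s^(p^e), and
inverting s is the same as inverting its powers. -/
theorem isLocalizedModule_localizationMap : IsLocalizedModule M (localizationMap (R := R) p e S) where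
  map_units s := by
    have hu : IsUnit (algebraMap R S s ^ p ^ e) := (IsLocalization.map_units S s).pow _
    rw [Module.End.isUnit_iff]
    constructor
    · intro x y hxy
      obtain ⟨x, rfl⟩ := (of R p e S).surjective x
      obtain ⟨y, rfl⟩ := (of R p e S).surjective y
      simp only [Module.algebraMap_end_apply, smul_of] at hxy
      rw [hu.mul_left_cancel ((of R p e S).injective hxy)]
    · intro x
      obtain ⟨x, rfl⟩ := (of R p e S).surjective x
      obtain ⟨v, hv⟩ := hu
      refine ⟨of R p e S (↑v⁻¹ * x), ?_⟩
      simp only [Module.algebraMap_end_apply, smul_of, ← hv, Units.mul_inv_cancel_left]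
  surj y := by
    obtain ⟨y, rfl⟩ := (of R p e S).surjective y
    obtain ⟨⟨a, s⟩, h⟩ := IsLocalization.surj M y
    -- With q = p^e and y = a/s, rewrite y = s^(q-1) a / s^q, since s acts by s^q.
    refine ⟨(FrobeniusPushforward.of R p e ((s : R) ^ (p ^ e - 1) * a), s), ?_⟩
    have hq : p ^ e = (p ^ e - 1) + 1 :=
      (Nat.sub_add_cancel (Nat.one_le_pow _ _ (Fact.out : p.Prime).pos)).symm
    change (s : R) • of R p e S y = of R p e S _
    rw [smul_of]
    congr 1
    dsimp only at h
    rw [AddEquiv.symm_apply_apply, map_mul, map_pow, ← h]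
    conv_lhs => rw [hq]
    ring
  exists_of_eq {x y} hxy := by
    obtain ⟨x, rfl⟩ := (FrobeniusPushforward.of R p e).surjective x
    obtain ⟨y, rfl⟩ := (FrobeniusPushforward.of R p e).surjective y
    have h : algebraMap R S x = algebraMap R S y := (of R p e S).injective hxy
    obtain ⟨c, hc⟩ := (IsLocalization.eq_iff_exists M S).mp h
    -- The same c works: c x = c y gives c^q x = c^q y because q ≥ 1.
    refine ⟨c, ?_⟩
    have hq : p ^ e = (p ^ e - 1) + 1 :=
      (Nat.sub_add_cancel (Nat.one_le_pow _ _ (Fact.out : p.Prime).pos)).symm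
    change (c : R) • FrobeniusPushforward.of R p e x = (c : R) • FrobeniusPushforward.of R p e y
    rw [FrobeniusPushforward.smul_of, FrobeniusPushforward.smul_of, hq, pow_succ, mul_assoc, hc,
      ← mul_assoc]

end LocalizedPushforward

open LocalizedPushforward

variable {p e} [Fact p.Prime] [CharP R p] (M : Submonoid R)
  (S : Type*) [CommRing S] [Algebra R S] [IsLocalization M S]
  (φ : FrobeniusPushforward R p e →ₗ[R] R)

variable (R) in
theorem isUnit_algebraMap_end (s : M) : IsUnit (algebraMap R (Module.End R S) s) := by
  rw [Module.End.isUnit_iff]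
  have hu := IsLocalization.map_units S s
  constructor
  · intro x y hxy
    simp only [Module.algebraMap_end_apply, Algebra.smul_def] at hxy
    exact hu.mul_left_cancel hxy
  · intro x
    obtain ⟨v, hv⟩ := hu
    refine ⟨↑v⁻¹ * x, ?_⟩
    simp only [Module.algebraMap_end_apply, Algebra.smul_def, ← hv, Units.mul_inv_cancel_left]

/-- The localization of `φ : F^e_* R → R` at `M`, as an `R`-linear map. -/
def localizedTraceLinear : LocalizedPushforward R S p e →ₗ[R] S :=
  haveI := isLocalizedModule_localizationMap (R := R) p e S M
  IsLocalizedModule.lift M (localizationMap (R := R) p e S) (Algebra.linearMap R S ∘ₗ φ)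
    (isUnit_algebraMap_end R M S)

/-- The localization of `φ : F^e_* R → R` at `M`, as an additive endomorphism of `S = M⁻¹R`. -/
def localizedTrace : S →+ S :=
  (localizedTraceLinear M S φ).toAddMonoidHom.comp (of R p e S).toAddMonoidHom

theorem localizedTrace_algebraMap (a : R) :
    localizedTrace M S φ (algebraMap R S a) =
      algebraMap R S (φ (FrobeniusPushforward.of R p e a)) := by
  have := isLocalizedModule_localizationMap (R := R) p e S M
  exact IsLocalizedModule.lift_apply M (localizationMap (R := R) p e S)
    (Algebra.linearMap R S ∘ₗ φ) (isUnit_algebraMap_end R M S) (FrobeniusPushforward.of R p e a)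

theorem localizedTrace_algebraMap_pow_mul (r : R) (y : S) :
    localizedTrace M S φ (algebraMap R S r ^ p ^ e * y) =
      algebraMap R S r * localizedTrace M S φ y := by
  rw [← Algebra.smul_def]
  change localizedTraceLinear M S φ (of R p e S _) = r • localizedTraceLinear M S φ (of R p e S y)
  rw [← LocalizedPushforward.smul_of, map_smul]

/-- Linearity over R extends to S: a denominator s of x may be cancelled after passing through the
trace as s^(p^e). -/
theorem localizedTrace_pow_mul (x y : S) :
    localizedTrace M S φ (x ^ p ^ e * y) = x * localizedTrace M S φ y := by
  obtain ⟨⟨a, s⟩, h⟩ := IsLocalization.surj M x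
  dsimp only at h
  refine (IsLocalization.map_units S s).mul_left_cancel ?_
  rw [← localizedTrace_algebraMap_pow_mul, ← mul_assoc, ← mul_pow, mul_comm _ x, h,
    localizedTrace_algebraMap_pow_mul, ← h]
  ring

/-- This naturality lets the localized traces act on the Čech complex. Once y is multiplied by
s^(p^e) it comes from R, where both sides are the image of the same value of φ. -/
theorem localizedTrace_map (N : Submonoid R) (T : Type*) [CommRing T] [Algebra R T]
    [IsLocalization N T] (ρ : S →ₐ[R] T) (y : S) :
    localizedTrace N T φ (ρ y) = ρ (localizedTrace M S φ y) := by
  obtain ⟨⟨a, s⟩, h⟩ := IsLocalization.surj M y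
  dsimp only at h
  have hu : IsUnit (algebraMap R T s) := by
    rw [← ρ.commutes]; exact (IsLocalization.map_units S s).map ρ
  have hq : p ^ e = (p ^ e - 1) + 1 :=
    (Nat.sub_add_cancel (Nat.one_le_pow _ _ (Fact.out : p.Prime).pos)).symm
  have h' : algebraMap R S s ^ p ^ e * y = algebraMap R S ((s : R) ^ (p ^ e - 1) * a) := by
    rw [map_mul, map_pow, ← h]
    conv_lhs => rw [hq]
    ring
  refine hu.mul_left_cancel ?_
  rw [← localizedTrace_algebraMap_pow_mul]
  conv_rhs => rw [← ρ.commutes, ← map_mul, ← localizedTrace_algebraMap_pow_mul, h',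
    localizedTrace_algebraMap, ρ.commutes]
  rw [← ρ.commutes, ← map_pow, ← map_mul, h', ρ.commutes, localizedTrace_algebraMap]

end LocalizedTrace

/-! ### Frobenius and traces on the Čech complex -/

section CechFrobenius

variable {R : Type*} [CommRing R] (p : ℕ) [Fact p.Prime] [CharP R p] (e : ℕ)

/-- The `e`-th iterate of Frobenius on an algebra (possibly zero) over a ring of
characteristic `p`. -/
def algebraIterateFrobenius (S : Type*) [CommRing S] [Algebra R S] : S →+* S where
  toFun x := x ^ p ^ e
  map_zero' := zero_pow (pow_ne_zero _ (Fact.out : p.Prime).ne_zero)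
  map_one' := one_pow _
  map_mul' x y := mul_pow x y _
  map_add' x y := by
    obtain ⟨r, hr⟩ := exists_add_pow_prime_pow_eq (Fact.out : p.Prime) x y e
    have hp : (p : S) = 0 := by
      rw [← map_natCast (algebraMap R S), CharP.cast_eq_zero, map_zero]
    rw [hr, hp]; ring

variable {n : ℕ} (f : Fin n → R)

theorem cechDifferential_apply (i : ℕ) (z : CechCochain f i)
    (t : {s : Finset (Fin n) // s.card = i + 1}) :
    cechDifferential f i z t = ∑ j : {j // j ∈ t.1},
      ((-1 : ℤ) ^ (t.1.filter (· < j.1)).card) •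
        cechRestrict f (Finset.erase_subset j.1 t.1)
          (z ⟨t.1.erase j.1, by simp [Finset.card_erase_of_mem j.2, t.2]⟩) := by
  simp [cechDifferential]

variable {f} in
/-- The additive endomorphism of the Čech cochains given by endomorphisms of the localizations. -/
def cechCochainMap (Φ : ∀ s : Finset (Fin n), CechLocalization f s →+ CechLocalization f s)
    (i : ℕ) : CechCochain f i →+ CechCochain f i :=
  AddMonoidHom.mk' (fun z s => Φ s.1 (z s)) fun z w => by
    funext s; exact map_add (Φ s.1) (z s) (w s)

variable {f} in
theorem cechCochainMap_apply
    (Φ : ∀ s : Finset (Fin n), CechLocalization f s →+ CechLocalization f s) (i : ℕ)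
    (z : CechCochain f i) (s : {s : Finset (Fin n) // s.card = i}) :
    cechCochainMap Φ i z s = Φ s.1 (z s) := rfl

/-- A family of additive endomorphisms of the terms of the Čech complex that commutes with the
restriction maps commutes with the differential. -/
theorem cechDifferential_cechCochainMap (Φ : ∀ s : Finset (Fin n),
      CechLocalization f s →+ CechLocalization f s)
    (hΦ : ∀ (s t : Finset (Fin n)) (h : s ⊆ t) (y : CechLocalization f s),
      Φ t (cechRestrict f h y) = cechRestrict f h (Φ s y)) (i : ℕ) (z : CechCochain f i) :
    cechDifferential f i (cechCochainMap Φ i z) =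
      cechCochainMap Φ (i + 1) (cechDifferential f i z) := by
  funext t
  rw [cechCochainMap_apply, cechDifferential_apply, cechDifferential_apply, map_sum]
  refine Finset.sum_congr rfl fun j _ => ?_
  rw [map_zsmul, hΦ, cechCochainMap_apply]

theorem cechCochainMap_mem_cechCoboundaries (Φ : ∀ s : Finset (Fin n),
      CechLocalization f s →+ CechLocalization f s)
    (hΦ : ∀ (s t : Finset (Fin n)) (h : s ⊆ t) (y : CechLocalization f s),
      Φ t (cechRestrict f h y) = cechRestrict f h (Φ s y)) {i : ℕ} {z : CechCochain f i}
    (hz : z ∈ cechCoboundaries f i) : cechCochainMap Φ i z ∈ cechCoboundaries f i := by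
  cases i with
  | zero =>
    obtain rfl : z = 0 := hz
    rw [map_zero]; exact zero_mem _
  | succ i =>
    obtain ⟨w, rfl⟩ := hz
    exact ⟨_, cechDifferential_cechCochainMap f Φ hΦ i w⟩

/-- Frobenius is additive in characteristic p and commutes with the restriction maps, which are ring
homomorphisms, so it commutes with the differential. -/
theorem pow_mem_cechCocycles {i : ℕ} {z : CechCochain f i} (hz : z ∈ cechCocycles f i) :
    (fun s => z s ^ p ^ e : CechCochain f i) ∈ cechCocycles f i := by
  have h := cechDifferential_cechCochainMap f
    (fun s => (algebraIterateFrobenius (R := R) p e (CechLocalization f s)).toAddMonoidHom)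
    (fun s t h y => (map_pow (cechRestrict f h) y _).symm) i z
  rw [cechCocycles, LinearMap.mem_ker] at hz ⊢
  refine h.trans ?_
  rw [hz, map_zero]

variable {p e}

/-- If `a · F^e(z)` is a coboundary, then so is `φ(a^{1/p^e}) · z`. -/
theorem smul_mem_cechCoboundaries_of_pow (φ : FrobeniusPushforward R p e →ₗ[R] R) (a : R) {i : ℕ}
    (z : CechCochain f i)
    (hz : a • (fun s => z s ^ p ^ e : CechCochain f i) ∈ cechCoboundaries f i) :
    φ (FrobeniusPushforward.of R p e a) • z ∈ cechCoboundaries f i := by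
  have h := cechCochainMap_mem_cechCoboundaries f
    (fun s => localizedTrace (.powers (∏ j ∈ s, f j)) (CechLocalization f s) φ)
    (fun s t h y => localizedTrace_map _ _ φ _ _ (cechRestrict f h) y) hz
  convert h using 1
  funext s
  rw [cechCochainMap_apply]
  simp only [Pi.smul_apply, Algebra.smul_def]
  rw [mul_comm (algebraMap _ _ a), localizedTrace_pow_mul, localizedTrace_algebraMap, mul_comm]

end CechFrobenius

/-! ### Degrees in local cohomology and the splitting prime -/

section GradedCech

variable {K R : Type*} [Field K] [CommRing R] [Algebra K R] {n : ℕ} (f : Fin n → R)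
  (𝒜 : ℕ → Submodule K R) [GradedAlgebra 𝒜]

variable {𝒜} in
theorem smul_mem_awayDegree {g : R} {α : ℤ} {x : Localization.Away g} (hx : x ∈ awayDegree 𝒜 g α)
    {m : ℕ} {r : R} (hr : r ∈ 𝒜 m) : r • x ∈ awayDegree 𝒜 g (m + α) := by
  rcases hx with ⟨k, a, b, s, hs, hg, h, hx⟩ | hx
  · refine Or.inl ⟨k, m + a, b, r * s, SetLike.mul_mem_graded hr hs, hg, by push_cast; omega, ?_⟩
    rw [smul_mul_assoc, hx, Algebra.smul_def, map_mul]
  · rw [Set.mem_singleton_iff] at hx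
    exact Or.inr (by rw [hx, smul_zero]; rfl)

variable {𝒜} in
-- A q-th power multiplies degrees by q, so degree 0 is preserved; this is where the value 0 of the
-- a-invariant matters.
theorem pow_mem_awayDegree {g : R} {x : Localization.Away g} (hx : x ∈ awayDegree 𝒜 g 0)
    {q : ℕ} (hq : q ≠ 0) : x ^ q ∈ awayDegree 𝒜 g 0 := by
  rcases hx with ⟨k, a, b, s, hs, hg, h, hx⟩ | hx
  · refine Or.inl ⟨k * q, q • a, q • b, s ^ q, SetLike.pow_mem_graded q hs, ?_, ?_, ?_⟩
    · rw [pow_mul]; exact SetLike.pow_mem_graded q hg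
    · obtain rfl : a = b := by omega
      simp
    · rw [pow_mul, map_pow, ← mul_pow, hx, map_pow]
  · rw [Set.mem_singleton_iff] at hx
    exact Or.inr (by rw [hx, zero_pow hq]; rfl)

theorem localCohomologyDegree_eq_bot_iff (i : ℕ) (α : ℤ) :
    localCohomologyDegree f 𝒜 i α = ⊥ ↔
      ∀ z ∈ cechCocycles f i, z ∈ cochainDegree f 𝒜 i α → z ∈ cechCoboundaries f i := by
  rw [localCohomologyDegree, AddSubgroup.map_eq_bot_iff]
  constructor
  · intro h z hz hd
    have := h (show (⟨z, hz⟩ : cechCocycles f i) ∈ _ from hd)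
    exact (Submodule.Quotient.mk_eq_zero ((cechCoboundaries f i).comap _)).mp this
  · rintro h ⟨z, hz⟩ hd
    exact (Submodule.Quotient.mk_eq_zero ((cechCoboundaries f i).comap _)).mpr (h z hz hd)

/-- If the local cohomology vanishes in positive degrees, then `𝔪` kills its degree zero part. -/
theorem smul_mem_cechCoboundaries_of_mem_irrelevantIdeal {i : ℕ}
    (hpos : ∀ α : ℤ, 0 < α → localCohomologyDegree f 𝒜 i α = ⊥)
    {z : CechCochain f i} (hz : z ∈ cechCocycles f i) (hd : z ∈ cochainDegree f 𝒜 i 0)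
    {r : R} (hr : r ∈ irrelevantIdeal 𝒜) : r • z ∈ cechCoboundaries f i := by
  classical
  rw [← DirectSum.sum_support_decompose 𝒜 r, Finset.sum_smul]
  refine Submodule.sum_mem _ fun m _ => ?_
  rcases Nat.eq_zero_or_pos m with rfl | hm
  · have h0 : (DirectSum.decompose 𝒜 r 0 : R) = 0 := by
      have := (HomogeneousIdeal.mem_irrelevant_iff 𝒜 r).mp hr
      rwa [GradedRing.proj_apply] at this
    rw [h0, zero_smul]; exact zero_mem _
  · refine (localCohomologyDegree_eq_bot_iff f 𝒜 i m).mp (hpos m (by exact_mod_cast hm)) _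
      (Submodule.smul_mem _ _ hz) ?_
    intro s _
    have := smul_mem_awayDegree (hd s trivial) (DirectSum.decompose 𝒜 r m).2
    rwa [add_zero] at this

variable {𝒜} in
-- The unit is the degree 0 component of u, a nonzero scalar because 𝒜 0 = K. It stands in for the
-- invertibility of u, which may fail as R is not local.
theorem exists_isUnit_sub_mem_irrelevantIdeal (hR : IsStandardGraded 𝒜) {u : R} (hu : u ∉ irrelevantIdeal 𝒜) :
    ∃ c : R, IsUnit c ∧ u - c ∈ irrelevantIdeal 𝒜 := by
  have hmem : (DirectSum.decompose 𝒜 u 0 : R) ∈ Set.range (algebraMap K R) := by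
    rw [hR.range_algebraMap]; exact (DirectSum.decompose 𝒜 u 0).2
  obtain ⟨k, hk⟩ := hmem
  have hk0 : k ≠ 0 := by
    rintro rfl
    refine hu ((HomogeneousIdeal.mem_irrelevant_iff 𝒜 u).mpr ?_)
    rw [GradedRing.proj_apply, ← hk, map_zero]
  refine ⟨algebraMap K R k, (IsUnit.mk0 k hk0).map _, ?_⟩
  refine (HomogeneousIdeal.mem_irrelevant_iff 𝒜 _).mpr ?_
  rw [hk, map_sub, GradedRing.proj_apply, GradedRing.proj_apply,
    DirectSum.decompose_coe, DirectSum.of_eq_same, sub_self]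

variable {𝒜} in
theorem isMaximal_irrelevantIdeal (hR : IsStandardGraded 𝒜) : (irrelevantIdeal 𝒜).IsMaximal := by
  have : Nontrivial R := hR.algebraMap_injective.nontrivial
  rw [Ideal.isMaximal_iff]
  constructor
  · intro h
    have := (HomogeneousIdeal.mem_irrelevant_iff 𝒜 1).mp h
    rw [GradedRing.proj_apply, DirectSum.decompose_of_mem_same 𝒜 SetLike.GradedOne.one_mem] at this
    exact one_ne_zero this
  · intro J x hJ hx hxJ
    obtain ⟨c, hc, hxc⟩ := exists_isUnit_sub_mem_irrelevantIdeal hR hx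
    have : c ∈ J := by simpa using sub_mem hxJ (hJ hxc)
    rw [J.eq_top_of_isUnit_mem this hc]; trivial

/-- An integer value excludes the default `⊥`, so the maximum is attained. -/
theorem isGreatest_of_aInvariant_eq_coe {i : ℕ} {a : ℤ} (h : aInvariant f 𝒜 i = a) :
    IsGreatest {α : ℤ | localCohomologyDegree f 𝒜 i α ≠ ⊥} a := by
  unfold aInvariant at h
  split_ifs at h with hex
  · rw [← WithBot.coe_injective h]
    exact hex.choose_spec
  · exact absurd h (WithBot.coe_ne_bot (a := a)).symm

variable (p : ℕ) [Fact p.Prime] [CharP R p]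

theorem splittingIdeal_zero_le : splittingIdeal p 𝒜 0 ≤ irrelevantIdeal 𝒜 := by
  intro r hr
  -- For e = 0 the pushforward is R itself, and φ can be the identity.
  exact hr
    { toFun := (FrobeniusPushforward.of R p 0).symm
      map_add' := map_add _
      map_smul' := fun a x => by
        obtain ⟨s, rfl⟩ := (FrobeniusPushforward.of R p 0).surjective x
        simp [FrobeniusPushforward.smul_of] }

variable {𝒜} in
theorem irrelevantIdeal_le_splittingIdeal (hR : IsStandardGraded 𝒜) {i : ℕ}
    (ha : IsGreatest {α : ℤ | localCohomologyDegree f 𝒜 i α ≠ ⊥} 0) (e : ℕ) :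
    irrelevantIdeal 𝒜 ≤ splittingIdeal p 𝒜 e := by
  intro r hr φ
  by_contra hu
  have hpos : ∀ α : ℤ, 0 < α → localCohomologyDegree f 𝒜 i α = ⊥ := fun α hα => by
    by_contra h
    exact absurd (ha.2 h) (not_le.mpr hα)
  refine ha.1 ((localCohomologyDegree_eq_bot_iff f 𝒜 i 0).mpr fun z hz hd => ?_)
  -- F^e(z) has degree 0, so r ∈ 𝔪 carries it to a coboundary; the trace turns this into
  -- φ(r^{1/p^e}) · z.
  have hu_smul := smul_mem_cechCoboundaries_of_pow f φ r z <|
    smul_mem_cechCoboundaries_of_mem_irrelevantIdeal f 𝒜 hpos (pow_mem_cechCocycles p e f hz)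
      (fun s _ => pow_mem_awayDegree (hd s trivial)
        (pow_ne_zero _ (Fact.out : p.Prime).ne_zero)) hr
  obtain ⟨c, hc, huc⟩ := exists_isUnit_sub_mem_irrelevantIdeal hR hu
  have hm := smul_mem_cechCoboundaries_of_mem_irrelevantIdeal f 𝒜 hpos hz hd huc
  -- c = u - (u - c), and both u and u - c send z to coboundaries.
  have hcz : c • z ∈ cechCoboundaries f i := by
    have := sub_mem hu_smul hm
    rwa [← sub_smul, sub_sub_cancel] at this
  exact (Submodule.smul_mem_iff_of_isUnit _ hc).mp hcz

end GradedCech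

end

theorem corollary4p4 {K R : Type*} [Field K] [CommRing R] [Algebra K R]
    (p : ℕ) [Fact p.Prime] [CharP R p]
    (𝒜 : ℕ → Submodule K R) [GradedAlgebra 𝒜] (hR : IsStandardGraded 𝒜)
    (hfin : IsFFinite R p) (hpure : IsFPure R p)
    {n : ℕ} (f : Fin n → R) (hhom : ∀ j, SetLike.IsHomogeneousElem 𝒜 (f j))
    (hgen : Ideal.span (Set.range f) = irrelevantIdeal 𝒜)
    (hai : ∃ i : ℕ, aInvariant f 𝒜 i = 0) :
    splittingPrime p 𝒜 = irrelevantIdeal 𝒜 ∧ splittingDim p 𝒜 = 0 := by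
  have heq : splittingPrime p 𝒜 = irrelevantIdeal 𝒜 := by
    obtain ⟨i, hi⟩ := hai
    have ha := isGreatest_of_aInvariant_eq_coe f 𝒜 (a := 0) hi
    exact le_antisymm ((iInf_le _ 0).trans (splittingIdeal_zero_le 𝒜 p))
      (le_iInf fun e => irrelevantIdeal_le_splittingIdeal f p hR ha e)
  refine ⟨heq, ?_⟩
  have := isMaximal_irrelevantIdeal hR
  letI := Ideal.Quotient.field (irrelevantIdeal 𝒜)
  rw [splittingDim, heq]
  exact ringKrullDim_eq_zero_of_field _
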